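/- A finite sequence of jobs is to be scheduled on a single processor. Job $j$ has a release time $r(j)\ge 0$ and a size $p(j)>0$; preemption is free, and at any time the processor runs at some speed $s\in[0,\infty)$, which may be shared among several active jobs (jobs released but not yet completed), consuming $P(s)=s^\alpha$ units of energy per unit time. The cost of a schedule is its total flow time $\sum_j (C(j)-r(j))$, where $C(j)$ is the completion time of $j$, plus its energy $\int_0^\infty s(t)^\alpha\,dt$. A deterministic algorithm is nonclairvoyant if its decisions at time $t$ (the speed, and how it is divided among the active jobs) depend only on the jobs released by time $t$, with their release times, and on the jobs completed by time $t$, with their completion times and sizes; the size of a job is unknown until the job is completed. The algorithm is $C$-competitive if on every job sequence its cost is at most $C$ times the infimum of the costs of all schedules of that sequence. For every $0<\varepsilon<1/3$ there is a constant $c=c(\varepsilon)>0$ such that for every $\alpha>1$ and every deterministic nonclairvoyant algorithm (which may depend on $\alpha$): if the algorithm is $C$-competitive for the power function $P(s)=s^\alpha$, then $C\ge c\,\alpha^{1/3-\varepsilon}$. That is, every deterministic nonclairvoyant algorithm has competitive ratio $\Omega(\alpha^{1/3-\varepsilon})$. -/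

import Mathlib

open MeasureTheory
open scoped NNReal ENNReal

noncomputable section

namespace SpeedScaling

/-- A finite job sequence: job `i` has release time `release i` and work requirement `size i`.
Jobs are listed in order of release (ties in any order), and the position in the list is the
identifier of the job, so that an identifier carries no information about later jobs. -/
structure Instance where
  n : ℕ
  release : Fin n → ℝ
  size : Fin n → ℝ
  release_nonneg : ∀ i, 0 ≤ release i
  release_mono : Monotone release
  size_pos : ∀ i, 0 < size i

/-- Work received during `[0, t]` by a job that is processed at rate `ρ`. -/
def workDone (ρ : ℝ → ℝ≥0) (t : ℝ) : ℝ≥0∞ :=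
  ∫⁻ τ in Set.Icc 0 t, (ρ τ : ℝ≥0∞)

/-- A preemptive schedule of `I` on one processor: `rate i t` is the part of the processor speed
that is given to job `i` at time `t`. Only active jobs (released by time `t` and not yet completed
by time `t`) are processed. A schedule need not complete every job; if it does not, its flow time
is infinite. -/
structure Schedule (I : Instance) where
  rate : Fin I.n → ℝ → ℝ≥0
  measurable_rate : ∀ i, Measurable (rate i)
  active_of_rate_ne_zero : ∀ i t, rate i t ≠ 0 →
    I.release i ≤ t ∧ workDone (rate i) t < ENNReal.ofReal (I.size i)

namespace Schedule

variable {I : Instance}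

/-- The speed of the processor at time `t`. -/
def speed (σ : Schedule I) (t : ℝ) : ℝ≥0 := ∑ i, σ.rate i t

/-- The first time at which job `i` has received its whole work requirement
(`∞` if this never happens). -/
def completionTime (σ : Schedule I) (i : Fin I.n) : ℝ≥0∞ :=
  ⨅ (t : ℝ) (_ : ENNReal.ofReal (I.size i) ≤ workDone (σ.rate i) t), ENNReal.ofReal t

/-- Time elapsed from the release of job `i` until its completion. -/
def flowTime (σ : Schedule I) (i : Fin I.n) : ℝ≥0∞ :=
  σ.completionTime i - ENNReal.ofReal (I.release i)

def totalFlowTime (σ : Schedule I) : ℝ≥0∞ := ∑ i, σ.flowTime i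

/-- Energy usage for the power function `P(s) = s ^ α`. -/
def energy (σ : Schedule I) (α : ℝ) : ℝ≥0∞ :=
  ∫⁻ t in Set.Ici (0 : ℝ), (σ.speed t : ℝ≥0∞) ^ α

/-- Total flow time plus energy. -/
def cost (σ : Schedule I) (α : ℝ) : ℝ≥0∞ := σ.totalFlowTime + σ.energy α

/-- The completions that have occurred by time `t`: the job, the time of its completion, and its
size, which is revealed at that moment. -/
def completions (σ : Schedule I) (t : ℝ) : Set (ℕ × ℝ≥0∞ × ℝ) :=
  {e | ∃ i : Fin I.n, σ.completionTime i ≤ ENNReal.ofReal t ∧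
    e = ((i : ℕ), σ.completionTime i, I.size i)}

end Schedule

/-- The arrivals that have occurred by time `t`: the job and its release time, but not its size. -/
def Instance.arrivals (I : Instance) (t : ℝ) : Set (ℕ × ℝ) :=
  {e | ∃ i : Fin I.n, I.release i ≤ t ∧ e = ((i : ℕ), I.release i)}

/-- The optimal offline cost of `I`. -/
def optCost (α : ℝ) (I : Instance) : ℝ≥0∞ := ⨅ σ : Schedule I, σ.cost α

/-- A deterministic online nonclairvoyant algorithm: it assigns a schedule to every job sequence,
and what it does at time `t` is determined by the arrivals and the completions that have
occurred by time `t`. -/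
structure NonclairvoyantAlgorithm where
  run : (I : Instance) → Schedule I
  nonclairvoyant : ∀ (I I' : Instance) (t : ℝ), 0 ≤ t →
    I.arrivals t = I'.arrivals t →
    (run I).completions t = (run I').completions t →
    ∀ (i : Fin I.n) (i' : Fin I'.n), (i : ℕ) = (i' : ℕ) → (run I).rate i t = (run I').rate i' t

/-- `A` is `C`-competitive for total flow time plus energy with power function `s ^ α`. -/
def NonclairvoyantAlgorithm.IsCompetitive (A : NonclairvoyantAlgorithm) (α C : ℝ) : Prop :=
  ∀ I : Instance, (A.run I).cost α ≤ ENNReal.ofReal C * optCost α I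

end SpeedScaling

end

/-!
Release `k` equal long jobs at time `0`. Bernoulli's inequality for `s ^ α` makes it expensive to
run noticeably above speed `1`, so a competitive algorithm does at most about `2 * k ^ 2 + k` work
until time `2 * k ^ 2`. Up to then it cannot tell these jobs from jobs that need only one unit more
than it has already given them. On the latter, an offline schedule completes all jobs but the
largest by time `2 * k ^ 2` and postpones that one while a stream of `k ^ 3` unit jobs arrives, one
per time unit; its cost is `O(k ^ 3)`. The algorithm enters the stream with `k` jobs that each need
one more unit. As it still cannot afford to be much faster than unit speed, it keeps at least
`k / 2` jobs active throughout the stream, at a flow time of at least `k ^ 4 / 2`. The tradeoff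
between speed and energy is strong enough for this as long as `k ^ 3` is at most of order `α`, so
that `k` can be taken of order `α ^ (1 / 3)`.
-/

namespace SpeedScaling

open Filter Function Set Topology

section workDone

variable {ρ ρ' : ℝ → ℝ≥0} {t : ℝ}

theorem workDone_mono (ρ : ℝ → ℝ≥0) : Monotone (workDone ρ) := fun _ _ h =>
  lintegral_mono_set (Icc_subset_Icc_right h)

theorem workDone_congr (h : ∀ s ∈ Ico 0 t, ρ s = ρ' s) : workDone ρ t = workDone ρ' t := by
  rw [workDone, workDone, ← setLIntegral_congr Ico_ae_eq_Icc, ← setLIntegral_congr Ico_ae_eq_Icc]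
  exact setLIntegral_congr_fun measurableSet_Ico fun s hs => by rw [h s hs]

theorem workDone_eq_zero (h : ∀ s ∈ Ico 0 t, ρ s = 0) : workDone ρ t = 0 := by
  rw [workDone_congr (ρ' := 0) h]
  simp [workDone]

theorem workDone_add_lintegral_Ioc (ρ : ℝ → ℝ≥0) {a b : ℝ} (ha : 0 ≤ a) (hab : a ≤ b) :
    workDone ρ a + ∫⁻ τ in Ioc a b, (ρ τ : ℝ≥0∞) = workDone ρ b := by
  rw [workDone, workDone, ← Icc_union_Ioc_eq_Icc ha hab, lintegral_union measurableSet_Ioc]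
  exact disjoint_left.2 fun _ hx hx' => hx.2.not_gt hx'.1

theorem workDone_le_of_forall_lt {c : ℝ≥0∞} (h : ∀ s < t, workDone ρ s ≤ c) :
    workDone ρ t ≤ c := by
  obtain ⟨u, hu_mono, hu_lt, hu_tendsto⟩ := exists_seq_strictMono_tendsto t
  have hIco : Ico 0 t = ⋃ n, Icc 0 (u n) := by
    rw [← Ici_inter_Iio, ← iUnion_Iic_eq_Iio_of_lt_of_tendsto hu_lt hu_tendsto, inter_iUnion]
    rfl
  rw [workDone, ← setLIntegral_congr Ico_ae_eq_Icc, hIco, setLIntegral_iUnion_of_directed]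
  · exact iSup_le fun n => h _ (hu_lt n)
  · exact directed_of_isDirected_le fun _ _ hmn => Icc_subset_Icc_right (hu_mono.monotone hmn)

theorem tendsto_workDone_nhdsGT {u : ℝ} (htu : t < u) (hu : workDone ρ u ≠ ∞) :
    Tendsto (workDone ρ) (𝓝[>] t) (𝓝 (workDone ρ t)) := by
  have hμ (s : ℝ) : volume.withDensity (fun τ => (ρ τ : ℝ≥0∞)) (Icc 0 s) = workDone ρ s :=
    withDensity_apply _ measurableSet_Icc
  have hIcc : ⋂ r > t, Icc 0 r = Icc 0 t := by
    ext x
    simp only [mem_iInter, mem_Icc]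
    exact ⟨fun h => ⟨(h u htu).1, le_of_forall_gt_imp_ge_of_dense fun r hr => (h r hr).2⟩,
      fun h r hr => ⟨h.1, h.2.trans hr.le⟩⟩
  have hlim := tendsto_measure_biInter_gt (μ := volume.withDensity fun τ => (ρ τ : ℝ≥0∞))
    (s := fun s => Icc 0 s) (a := t) (fun _ _ => measurableSet_Icc.nullMeasurableSet)
    (fun _ _ _ h => Icc_subset_Icc_right h) ⟨u, htu, by rwa [hμ]⟩
  rw [hIcc, hμ] at hlim
  exact hlim.congr hμ

theorem workDone_indicator_Ico {a b : ℝ} (ha : 0 ≤ a) (t : ℝ) :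
    workDone ((Ico a b).indicator 1) t = ENNReal.ofReal (min t b - a) := by
  have hcoe : (fun τ => (((Ico a b).indicator 1 τ : ℝ≥0) : ℝ≥0∞)) = (Ico a b).indicator 1 := by
    ext τ
    by_cases hτ : τ ∈ Ico a b <;> simp [hτ]
  rw [workDone, ← setLIntegral_congr Ico_ae_eq_Icc, hcoe, lintegral_indicator_one measurableSet_Ico,
    Measure.restrict_apply measurableSet_Ico, Ico_inter_Ico, max_eq_left ha, min_comm,
    Real.volume_Ico]

end workDone

theorem le_add_inv_mul_rpow {α l s : ℝ} (hα : 1 ≤ α) (hl : 0 < l) (hs : 0 ≤ s) :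
    s ≤ l + (α * l ^ (α - 1))⁻¹ * s ^ α := by
  have hbern := one_add_mul_self_le_rpow_one_add (s := s / l - 1)
    (by linarith [div_nonneg hs hl.le]) hα
  rw [add_sub_cancel, Real.div_rpow hs hl.le] at hbern
  have hdiv : α * (s / l - 1) ≤ s ^ α / l ^ α := by linarith
  calc s = l + (α * l ^ (α - 1))⁻¹ * (l ^ α * (α * (s / l - 1))) := by
        rw [Real.rpow_sub_one hl.ne']
        field_simp
        ring
    _ ≤ l + (α * l ^ (α - 1))⁻¹ * (l ^ α * (s ^ α / l ^ α)) := by gcongr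
    _ = l + (α * l ^ (α - 1))⁻¹ * s ^ α := by rw [mul_div_cancel₀ _ (by positivity)]

namespace Schedule

variable {I : Instance} (σ : Schedule I)

theorem rate_eq_zero_of_lt_release {i : Fin I.n} {t : ℝ} (h : t < I.release i) :
    σ.rate i t = 0 := by
  by_contra hne
  exact (σ.active_of_rate_ne_zero i t hne).1.not_gt h

theorem workDone_le_size (i : Fin I.n) (t : ℝ) :
    workDone (σ.rate i) t ≤ ENNReal.ofReal (I.size i) := by
  by_contra! hover
  set S : Set ℝ := {s | workDone (σ.rate i) s < ENNReal.ofReal (I.size i)}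
  have hupper : t ∈ upperBounds S := fun s hs => by
    by_contra! hts
    exact (hs.trans hover).not_ge (workDone_mono _ hts.le)
  have hzero_mem : 0 ∈ S := by
    change workDone (σ.rate i) 0 < _
    rw [workDone_eq_zero (by simp)]
    exact ENNReal.ofReal_pos.2 (I.size_pos i)
  have hbefore : workDone (σ.rate i) (sSup S) ≤ ENNReal.ofReal (I.size i) :=
    workDone_le_of_forall_lt fun s hs => by
      obtain ⟨s', hs', hss'⟩ := exists_lt_of_lt_csSup ⟨0, hzero_mem⟩ hs
      exact (workDone_mono _ hss'.le).trans (le_of_lt hs')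
  have hafter : ∫⁻ τ in Ioc (sSup S) t, (σ.rate i τ : ℝ≥0∞) = 0 :=
    setLIntegral_eq_zero measurableSet_Ioc fun s hs => by
      have hs_rate : σ.rate i s = 0 := by
        by_contra hne
        exact hs.1.not_ge (le_csSup ⟨t, hupper⟩ (σ.active_of_rate_ne_zero i s hne).2)
      simp [hs_rate]
  rw [← workDone_add_lintegral_Ioc _ (le_csSup ⟨t, hupper⟩ hzero_mem)
    (csSup_le ⟨0, hzero_mem⟩ hupper), hafter, add_zero] at hover
  exact hover.not_ge hbefore

theorem workDone_ne_top (i : Fin I.n) (t : ℝ) : workDone (σ.rate i) t ≠ ∞ :=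
  ne_top_of_le_ne_top ENNReal.ofReal_ne_top (σ.workDone_le_size i t)

/-- The work received by job `i` during `[0, t]`, as a real number; it is finite because only
active jobs are processed. -/
noncomputable def work (i : Fin I.n) (t : ℝ) : ℝ := (workDone (σ.rate i) t).toReal

/-- The work received by all jobs together during `[0, t]`. -/
noncomputable def totalWork (t : ℝ) : ℝ := ∑ i, σ.work i t

theorem ofReal_work (i : Fin I.n) (t : ℝ) :
    ENNReal.ofReal (σ.work i t) = workDone (σ.rate i) t :=
  ENNReal.ofReal_toReal (σ.workDone_ne_top i t)

theorem work_nonneg (i : Fin I.n) (t : ℝ) : 0 ≤ σ.work i t := ENNReal.toReal_nonneg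

theorem totalWork_nonneg (t : ℝ) : 0 ≤ σ.totalWork t :=
  Finset.sum_nonneg fun i _ => σ.work_nonneg i t

theorem work_mono (i : Fin I.n) : Monotone (σ.work i) := fun _ t h =>
  ENNReal.toReal_mono (σ.workDone_ne_top i t) (workDone_mono _ h)

theorem work_eq_zero_of_le_release {i : Fin I.n} {t : ℝ} (h : t ≤ I.release i) :
    σ.work i t = 0 := by
  rw [work, workDone_eq_zero fun s hs => σ.rate_eq_zero_of_lt_release (hs.2.trans_le h),
    ENNReal.toReal_zero]

theorem totalWork_zero : σ.totalWork 0 = 0 :=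
  Finset.sum_eq_zero fun i _ => σ.work_eq_zero_of_le_release (I.release_nonneg i)

theorem ofReal_totalWork (t : ℝ) :
    ENNReal.ofReal (σ.totalWork t) = ∑ i, workDone (σ.rate i) t := by
  simp only [totalWork, ENNReal.ofReal_sum_of_nonneg fun i _ => σ.work_nonneg i t, ofReal_work]

theorem lt_completionTime {i : Fin I.n} {t : ℝ} (ht : 0 ≤ t) (h : σ.work i t < I.size i) :
    ENNReal.ofReal t < σ.completionTime i := by
  have hwork : workDone (σ.rate i) t < ENNReal.ofReal (I.size i) := by
    rw [← ofReal_work]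
    exact (ENNReal.ofReal_lt_ofReal_iff (I.size_pos i)).2 h
  obtain ⟨u, hu, htu⟩ := (((tendsto_workDone_nhdsGT (lt_add_one t)
    (σ.workDone_ne_top i _)).eventually_lt_const hwork).and self_mem_nhdsWithin).exists
  calc ENNReal.ofReal t < ENNReal.ofReal u := (ENNReal.ofReal_lt_ofReal_iff (ht.trans_lt htu)).2 htu
    _ ≤ σ.completionTime i := le_iInf₂ fun s hs => ENNReal.ofReal_le_ofReal <| by
        by_contra! hsu
        exact (hs.trans (workDone_mono _ hsu.le)).not_gt hu

theorem completions_eq_empty {t : ℝ} (h : ∀ i, ENNReal.ofReal t < σ.completionTime i) :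
    σ.completions t = ∅ := by
  refine eq_empty_iff_forall_notMem.2 ?_
  rintro _ ⟨i, hi, -⟩
  exact hi.not_gt (h i)

theorem measurable_coe_speed : Measurable fun t => (σ.speed t : ℝ≥0∞) :=
  (Finset.measurable_fun_sum _ fun i _ => σ.measurable_rate i).coe_nnreal_ennreal

theorem ofReal_totalWork_add_lintegral_speed {a b : ℝ} (ha : 0 ≤ a) (hab : a ≤ b) :
    ENNReal.ofReal (σ.totalWork a) + ∫⁻ τ in Ioc a b, (σ.speed τ : ℝ≥0∞)
      = ENNReal.ofReal (σ.totalWork b) := by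
  simp only [ofReal_totalWork, speed, ENNReal.ofNNReal_finsetSum]
  rw [lintegral_finsetSum _ fun i _ => (σ.measurable_rate i).coe_nnreal_ennreal,
    ← Finset.sum_add_distrib]
  exact Finset.sum_congr rfl fun i _ => workDone_add_lintegral_Ioc _ ha hab

/-- The number of active jobs (released but not yet completed) at time `t`. -/
noncomputable def numActive (t : ℝ) : ℕ :=
  Finset.card {i | I.release i ≤ t ∧ ENNReal.ofReal t < σ.completionTime i}

theorem volume_active (i : Fin I.n) :
    volume {t | I.release i ≤ t ∧ ENNReal.ofReal t < σ.completionTime i} = σ.flowTime i := by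
  have hr := I.release_nonneg i
  by_cases htop : σ.completionTime i = ∞
  · have : {t | I.release i ≤ t ∧ ENNReal.ofReal t < σ.completionTime i} = Ici (I.release i) := by
      ext t
      simp [htop]
    rw [this, Real.volume_Ici, flowTime, htop, ENNReal.top_sub ENNReal.ofReal_ne_top]
  · have : {t | I.release i ≤ t ∧ ENNReal.ofReal t < σ.completionTime i}
        = Ico (I.release i) (σ.completionTime i).toReal :=
      ext fun t => and_congr_right fun ht => ENNReal.ofReal_lt_iff_lt_toReal (hr.trans ht) htop
    rw [this, Real.volume_Ico, ENNReal.ofReal_sub _ hr, ENNReal.ofReal_toReal htop, flowTime]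

theorem lintegral_numActive : ∫⁻ t, (σ.numActive t : ℝ≥0∞) = σ.totalFlowTime := by
  have hmeas (i : Fin I.n) :
      MeasurableSet {t | I.release i ≤ t ∧ ENNReal.ofReal t < σ.completionTime i} :=
    measurableSet_Ici.inter (ENNReal.measurable_ofReal measurableSet_Iio)
  calc ∫⁻ t, (σ.numActive t : ℝ≥0∞)
      = ∫⁻ t, ∑ i, {t | I.release i ≤ t ∧ ENNReal.ofReal t < σ.completionTime i}.indicator 1 t := by
        simp only [numActive, Finset.card_filter, Nat.cast_sum, Nat.cast_ite, Nat.cast_one,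
          Nat.cast_zero, indicator_apply, mem_ofPred_eq, Pi.one_apply]
    _ = ∑ i, volume {t | I.release i ≤ t ∧ ENNReal.ofReal t < σ.completionTime i} := by
        rw [lintegral_finsetSum _ fun i _ => measurable_one.indicator (hmeas i)]
        exact Finset.sum_congr rfl fun i _ => lintegral_indicator_one (hmeas i)
    _ = σ.totalFlowTime := Finset.sum_congr rfl fun i _ => σ.volume_active i

theorem mul_le_totalFlowTime {a b N : ℝ} (h : ∀ t ∈ Icc a b, N ≤ σ.numActive t) :
    ENNReal.ofReal N * ENNReal.ofReal (b - a) ≤ σ.totalFlowTime :=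
  calc ENNReal.ofReal N * ENNReal.ofReal (b - a) = ∫⁻ _ in Icc a b, ENNReal.ofReal N := by
        rw [setLIntegral_const, Real.volume_Icc]
    _ ≤ ∫⁻ t in Icc a b, (σ.numActive t : ℝ≥0∞) :=
        setLIntegral_mono' measurableSet_Icc fun t ht => by
          simpa using ENNReal.ofReal_le_ofReal (h t ht)
    _ ≤ σ.totalFlowTime := (setLIntegral_le_lintegral _ _).trans_eq σ.lintegral_numActive

/-- A job that has at least one unit of work left at time `a` and is completed by time `b` accounts
for one unit of the work done in between. -/
theorem card_released_sub_le_numActive {a b : ℝ} (hb : 0 ≤ b) (hab : a ≤ b)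
    (hrem : ∀ i, I.release i ≤ b → σ.work i a + 1 ≤ I.size i) :
    (Finset.card {i | I.release i ≤ b} : ℝ) - (σ.totalWork b - σ.totalWork a) ≤ σ.numActive b := by
  have hjob (i : Fin I.n) : (if I.release i ≤ b then (1 : ℝ) else 0) - (σ.work i b - σ.work i a)
      ≤ if I.release i ≤ b ∧ ENNReal.ofReal b < σ.completionTime i then 1 else 0 := by
    have hmono := σ.work_mono i hab
    by_cases hrel : I.release i ≤ b
    · by_cases hact : ENNReal.ofReal b < σ.completionTime i
      · rw [if_pos hrel, if_pos ⟨hrel, hact⟩]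
        linarith
      · have hdone := not_lt.1 (mt (σ.lt_completionTime hb) hact)
        rw [if_pos hrel, if_neg fun h => hact h.2]
        linarith [hrem i hrel]
    · rw [if_neg hrel, if_neg fun h => hrel h.1]
      linarith
  simpa [Finset.sum_sub_distrib, totalWork, numActive] using
    Finset.sum_le_sum fun i (_ : i ∈ Finset.univ) => hjob i

theorem lintegral_speed_le {α l : ℝ} (hα : 1 ≤ α) (hl : 0 < l) {a b : ℝ} (ha : 0 ≤ a) :
    ∫⁻ t in Ioc a b, (σ.speed t : ℝ≥0∞)
      ≤ ENNReal.ofReal (l * (b - a)) + ENNReal.ofReal (α * l ^ (α - 1))⁻¹ * σ.energy α := by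
  have hκ : 0 ≤ (α * l ^ (α - 1))⁻¹ := by positivity
  calc ∫⁻ t in Ioc a b, (σ.speed t : ℝ≥0∞)
      ≤ ∫⁻ t in Ioc a b,
          (ENNReal.ofReal l + ENNReal.ofReal (α * l ^ (α - 1))⁻¹ * (σ.speed t : ℝ≥0∞) ^ α) := by
        refine lintegral_mono fun t => ?_
        have h := ENNReal.ofReal_le_ofReal (le_add_inv_mul_rpow hα hl (σ.speed t).coe_nonneg)
        rwa [ENNReal.ofReal_add hl.le (by positivity), ENNReal.ofReal_mul hκ,
          ← ENNReal.ofReal_rpow_of_nonneg (NNReal.coe_nonneg _) (by linarith),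
          ENNReal.ofReal_coe_nnreal] at h
    _ = ENNReal.ofReal (l * (b - a))
        + ENNReal.ofReal (α * l ^ (α - 1))⁻¹ * ∫⁻ t in Ioc a b, (σ.speed t : ℝ≥0∞) ^ α := by
        rw [lintegral_add_left measurable_const, setLIntegral_const, Real.volume_Ioc,
          ENNReal.ofReal_mul hl.le, lintegral_const_mul' _ _ ENNReal.ofReal_ne_top]
    _ ≤ _ := by
        gcongr
        exact lintegral_mono_set fun t ht => ha.trans ht.1.le

theorem totalWork_le {α l : ℝ} (hα : 1 ≤ α) (hl : 0 < l) {a b : ℝ} (ha : 0 ≤ a) (hab : a ≤ b)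
    {E : ℝ} (hE : 0 ≤ E) (henergy : σ.energy α ≤ ENNReal.ofReal E) :
    σ.totalWork b ≤ σ.totalWork a + (l * (b - a) + (α * l ^ (α - 1))⁻¹ * E) := by
  have hκ : 0 ≤ (α * l ^ (α - 1))⁻¹ := by positivity
  have hl_ab : 0 ≤ l * (b - a) := mul_nonneg hl.le (sub_nonneg.2 hab)
  have hwork := σ.totalWork_nonneg a
  rw [← ENNReal.ofReal_le_ofReal_iff (by positivity), ENNReal.ofReal_add hwork (by positivity),
    ENNReal.ofReal_add hl_ab (by positivity), ENNReal.ofReal_mul hκ,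
    ← σ.ofReal_totalWork_add_lintegral_speed ha hab]
  gcongr
  exact (σ.lintegral_speed_le hα hl ha).trans (by gcongr)

theorem completionTime_eq_top_of_energy_eq_zero {α : ℝ} (hα : 0 < α) (h : σ.energy α = 0)
    (i : Fin I.n) : σ.completionTime i = ∞ := by
  have hspeed := (setLIntegral_eq_zero_iff measurableSet_Ici
    (σ.measurable_coe_speed.pow_const α)).1 h
  have hwork (t : ℝ) : workDone (σ.rate i) t = 0 := by
    refine (setLIntegral_eq_zero_iff measurableSet_Icc
      (σ.measurable_rate i).coe_nnreal_ennreal).2 ?_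
    filter_upwards [hspeed] with s hs hst
    have hspeed_zero : σ.speed s = 0 := by
      simpa [ENNReal.rpow_eq_zero_iff_of_pos hα] using hs hst.1
    simpa using Finset.sum_eq_zero_iff.1 hspeed_zero i (Finset.mem_univ i)
  refine iInf₂_eq_top.2 fun t ht => absurd ht ?_
  rw [hwork t]
  exact (ENNReal.ofReal_pos.2 (I.size_pos i)).not_ge

theorem cost_ne_zero {α : ℝ} (hα : 0 < α) (i : Fin I.n) : σ.cost α ≠ 0 := by
  intro h
  obtain ⟨hflow, henergy⟩ := add_eq_zero.1 h
  have hflow_i : σ.flowTime i = 0 := Finset.sum_eq_zero_iff.1 hflow i (Finset.mem_univ i)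
  rw [flowTime, σ.completionTime_eq_top_of_energy_eq_zero hα henergy i,
    ENNReal.top_sub ENNReal.ofReal_ne_top] at hflow_i
  exact ENNReal.top_ne_zero hflow_i

/-- The nonpreemptive schedule that processes each job `i` at unit speed from time `start i` on. -/
noncomputable def ofStart (start : Fin I.n → ℝ) (hstart : ∀ i, I.release i ≤ start i) :
    Schedule I where
  rate i := (Ico (start i) (start i + I.size i)).indicator 1
  measurable_rate i := measurable_one.indicator measurableSet_Ico
  active_of_rate_ne_zero i t ht := by
    have hmem : t ∈ Ico (start i) (start i + I.size i) := mem_of_indicator_ne_zero ht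
    refine ⟨(hstart i).trans hmem.1, ?_⟩
    rw [workDone_indicator_Ico ((I.release_nonneg i).trans (hstart i)), min_eq_left hmem.2.le,
      ENNReal.ofReal_lt_ofReal_iff (I.size_pos i)]
    linarith [hmem.2]

theorem completionTime_ofStart_le (start : Fin I.n → ℝ) (hstart : ∀ i, I.release i ≤ start i)
    (i : Fin I.n) :
    (ofStart start hstart).completionTime i ≤ ENNReal.ofReal (start i + I.size i) := by
  have hwork := workDone_indicator_Ico (b := start i + I.size i)
    ((I.release_nonneg i).trans (hstart i)) (start i + I.size i)
  rw [min_self, add_sub_cancel_left] at hwork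
  exact iInf₂_le (start i + I.size i) hwork.ge

theorem speed_ofStart (start : Fin I.n → ℝ) (hstart : ∀ i, I.release i ≤ start i)
    (hdisj : Pairwise (Disjoint on fun i => Ico (start i) (start i + I.size i))) (t : ℝ) :
    (ofStart start hstart).speed t = (⋃ i, Ico (start i) (start i + I.size i)).indicator 1 t := by
  by_cases ht : ∃ i, t ∈ Ico (start i) (start i + I.size i)
  · obtain ⟨i, hi⟩ := ht
    have hother (j : Fin I.n) (hji : j ≠ i) : (ofStart start hstart).rate j t = 0 :=
      indicator_of_notMem (disjoint_left.1 (hdisj hji.symm) hi) _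
    rw [speed, Fintype.sum_eq_single i hother, indicator_of_mem (mem_iUnion_of_mem i hi)]
    exact indicator_of_mem hi _
  · rw [indicator_of_notMem (by simpa using ht)]
    exact Finset.sum_eq_zero fun j _ => indicator_of_notMem (fun hj => ht ⟨j, hj⟩) _

theorem energy_ofStart {α : ℝ} (hα : 0 < α) (start : Fin I.n → ℝ)
    (hstart : ∀ i, I.release i ≤ start i)
    (hdisj : Pairwise (Disjoint on fun i => Ico (start i) (start i + I.size i))) :
    (ofStart start hstart).energy α = ∑ i, ENNReal.ofReal (I.size i) := by
  set busy := ⋃ i, Ico (start i) (start i + I.size i)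
  have hbusy : MeasurableSet busy := .iUnion fun i => measurableSet_Ico
  have hnonneg : busy ⊆ Ici 0 := iUnion_subset fun i t ht =>
    (I.release_nonneg i).trans ((hstart i).trans ht.1)
  have hpow (t : ℝ) : ((ofStart start hstart).speed t : ℝ≥0∞) ^ α = busy.indicator 1 t := by
    rw [speed_ofStart start hstart hdisj]
    by_cases ht : t ∈ busy <;> simp [ht, busy, hα]
  calc (ofStart start hstart).energy α = volume busy := by
        rw [energy, lintegral_congr hpow, lintegral_indicator_one hbusy,
          Measure.restrict_apply hbusy, inter_eq_left.2 hnonneg]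
    _ = ∑ i, ENNReal.ofReal (I.size i) := by
        rw [measure_iUnion hdisj fun _ => measurableSet_Ico, tsum_fintype]
        simp only [Real.volume_Ico, add_sub_cancel_left]

end Schedule

theorem optCost_le_of_start {I : Instance} {α : ℝ} (hα : 0 < α) (start : Fin I.n → ℝ)
    (hstart : ∀ i, I.release i ≤ start i)
    (hdisj : Pairwise (Disjoint on fun i => Ico (start i) (start i + I.size i))) :
    optCost α I ≤ ENNReal.ofReal (∑ i, (start i - I.release i + 2 * I.size i)) := by
  have hsize (i : Fin I.n) : 0 ≤ I.size i := (I.size_pos i).le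
  have hwait (i : Fin I.n) : 0 ≤ start i - I.release i := sub_nonneg.2 (hstart i)
  calc optCost α I ≤ (Schedule.ofStart start hstart).cost α := iInf_le _ _
    _ = ∑ i, ((Schedule.ofStart start hstart).flowTime i + ENNReal.ofReal (I.size i)) := by
        rw [Schedule.cost, Schedule.energy_ofStart hα start hstart hdisj, Schedule.totalFlowTime,
          Finset.sum_add_distrib]
    _ ≤ ∑ i, ENNReal.ofReal (start i - I.release i + 2 * I.size i) := by
        refine Finset.sum_le_sum fun i _ => ?_
        rw [show start i - I.release i + 2 * I.size i
            = start i + I.size i - I.release i + I.size i by ring,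
          ENNReal.ofReal_add (by linarith [hwait i, hsize i]) (hsize i),
          ENNReal.ofReal_sub _ (I.release_nonneg i), Schedule.flowTime]
        gcongr
        exact Schedule.completionTime_ofStart_le start hstart i
    _ = ENNReal.ofReal (∑ i, (start i - I.release i + 2 * I.size i)) :=
        (ENNReal.ofReal_sum_of_nonneg fun i _ => by linarith [hwait i, hsize i]).symm

section packedStart

variable {ι : Type*} [LinearOrder ι] {s : Finset ι} {p : ι → ℝ}

/-- The start times at which the jobs of `s`, of sizes `p`, are processed one after the other from
time `0` on. -/
noncomputable def packedStart (s : Finset ι) (p : ι → ℝ) (i : ι) : ℝ := ∑ j ∈ s with j < i, p j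

theorem packedStart_nonneg (hp : ∀ i, 0 ≤ p i) (i : ι) : 0 ≤ packedStart s p i :=
  Finset.sum_nonneg fun j _ => hp j

theorem packedStart_add {i : ι} (hi : i ∈ s) :
    packedStart s p i + p i = ∑ j ∈ s with j ≤ i, p j := by
  rw [packedStart, add_comm, ← Finset.sum_insert (by simp)]
  congr 1
  ext j
  simp only [Finset.mem_insert, Finset.mem_filter, le_iff_lt_or_eq]
  grind

theorem packedStart_add_le_sum (hp : ∀ i, 0 ≤ p i) {i : ι} (hi : i ∈ s) :
    packedStart s p i + p i ≤ ∑ j ∈ s, p j := by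
  rw [packedStart_add hi]
  exact Finset.sum_le_sum_of_subset_of_nonneg (Finset.filter_subset _ _) fun j _ _ => hp j

theorem packedStart_add_le (hp : ∀ i, 0 ≤ p i) {i j : ι} (hi : i ∈ s) (hij : i < j) :
    packedStart s p i + p i ≤ packedStart s p j := by
  rw [packedStart_add hi]
  exact Finset.sum_le_sum_of_subset_of_nonneg
    (Finset.monotone_filter_right s fun _ _ h => h.trans_lt hij) fun j _ _ => hp j

end packedStart

/-- `k` jobs of sizes `p` released at time `0`. -/
def burst {k : ℕ} (p : Fin k → ℝ) (hp : ∀ i, 0 < p i) : Instance where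
  n := k
  release _ := 0
  size := p
  release_nonneg _ := le_rfl
  release_mono := monotone_const
  size_pos := hp

theorem optCost_burst_le {α : ℝ} (hα : 0 < α) {k : ℕ} (p : Fin k → ℝ) (hp : ∀ i, 0 < p i) :
    optCost α (burst p hp) ≤ ENNReal.ofReal ((k + 1) * ∑ i, p i) := by
  have hp' (i : Fin k) : 0 ≤ p i := (hp i).le
  refine (optCost_le_of_start (I := burst p hp) hα (packedStart Finset.univ p)
    (packedStart_nonneg hp') ?_).trans (ENNReal.ofReal_le_ofReal ?_)
  · exact (pairwise_disjoint_on _).2 fun i j hij => Ico_disjoint_Ico.2 <|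
      (min_le_left _ _).trans <| (packedStart_add_le hp' (Finset.mem_univ i) hij).trans <|
        le_max_right _ _
  · calc ∑ i : Fin k, (packedStart Finset.univ p i - 0 + 2 * p i)
        ≤ ∑ i : Fin k, (∑ j, p j + p i) := Finset.sum_le_sum fun i _ => by
          linarith [packedStart_add_le_sum hp' (Finset.mem_univ i)]
      _ = (k + 1) * ∑ i, p i := by
          simp only [Finset.sum_add_distrib, Finset.sum_const, Finset.card_univ, Fintype.card_fin,
            nsmul_eq_mul]
          ring

/-- `k` jobs of sizes `p` released at time `0`, followed by a stream of `L` unit jobs released one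
per time unit from time `T` on. -/
def burstThenStream {k : ℕ} (p : Fin k → ℝ) (hp : ∀ i, 0 < p i) (L : ℕ) {T : ℝ} (hT : 0 ≤ T) :
    Instance where
  n := k + L
  release i := if (i : ℕ) < k then 0 else T + ((i : ℕ) - k : ℕ)
  size := Fin.append p 1
  release_nonneg i := by split_ifs <;> positivity
  release_mono i j hij := by
    have hij : (i : ℕ) ≤ j := hij
    dsimp only
    split_ifs with hi hj
    · exact le_rfl
    · positivity
    · omega
    · gcongr
  size_pos := by
    refine Fin.addCases (fun i => ?_) (fun j => ?_)
    · rw [Fin.append_left]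
      exact hp i
    · rw [Fin.append_right]
      exact one_pos

section burstThenStream

variable {k : ℕ} (p : Fin k → ℝ) (hp : ∀ i, 0 < p i) (L : ℕ) {T : ℝ} (hT : 0 ≤ T)

theorem burstThenStream_release_castAdd (i : Fin k) :
    (burstThenStream p hp L hT).release (Fin.castAdd L i) = 0 := by
  simp [burstThenStream]

theorem burstThenStream_release_natAdd (j : Fin L) :
    (burstThenStream p hp L hT).release (Fin.natAdd k j) = T + (j : ℕ) := by
  simp [burstThenStream]

theorem burstThenStream_size_castAdd (i : Fin k) :
    (burstThenStream p hp L hT).size (Fin.castAdd L i) = p i :=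
  Fin.append_left p (1 : Fin L → ℝ) i

theorem burstThenStream_size_natAdd (j : Fin L) :
    (burstThenStream p hp L hT).size (Fin.natAdd k j) = 1 :=
  Fin.append_right p (1 : Fin L → ℝ) j

end burstThenStream

/-- Start times for `burstThenStream` that process the burst one job after the other, except for
job `m`, then every job of the stream at its release, and finally job `m`. -/
noncomputable def postponedStart {k : ℕ} (p : Fin k → ℝ) (L : ℕ) (T : ℝ) (m : Fin k) :
    Fin (k + L) → ℝ :=
  Fin.append (update (packedStart (Finset.univ.erase m) p) m (T + L)) fun j => T + (j : ℕ)

section postponedStart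

variable {k : ℕ} {p : Fin k → ℝ} {L : ℕ} {T : ℝ} {m : Fin k}

theorem postponedStart_castAdd_self : postponedStart p L T m (Fin.castAdd L m) = T + L := by
  rw [postponedStart, Fin.append_left, update_self]

theorem postponedStart_castAdd {i : Fin k} (hi : i ≠ m) :
    postponedStart p L T m (Fin.castAdd L i) = packedStart (Finset.univ.erase m) p i := by
  rw [postponedStart, Fin.append_left, update_of_ne hi]

theorem postponedStart_natAdd (j : Fin L) :
    postponedStart p L T m (Fin.natAdd k j) = T + (j : ℕ) :=
  Fin.append_right _ _ j

theorem postponedStart_castAdd_add_le (hp : ∀ i, 0 < p i) (hm : ∑ i, p i - p m ≤ T) {i : Fin k}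
    (hi : i ≠ m) : postponedStart p L T m (Fin.castAdd L i) + p i ≤ T := by
  rw [postponedStart_castAdd hi]
  refine (packedStart_add_le_sum (fun i => (hp i).le) (by simpa using hi)).trans ?_
  rwa [Finset.sum_erase_eq_sub (Finset.mem_univ m)]

theorem release_le_postponedStart (hp : ∀ i, 0 < p i) (hT : 0 ≤ T) (i : Fin (k + L)) :
    (burstThenStream p hp L hT).release i ≤ postponedStart p L T m i := by
  induction i using Fin.addCases with
  | left i =>
    rw [burstThenStream_release_castAdd]
    rcases eq_or_ne i m with rfl | hi
    · rw [postponedStart_castAdd_self]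
      positivity
    · rw [postponedStart_castAdd hi]
      exact packedStart_nonneg (fun i => (hp i).le) i
  | right j => rw [burstThenStream_release_natAdd, postponedStart_natAdd]

theorem postponedStart_castAdd_add_le_castAdd (hp : ∀ i, 0 < p i) (hm : ∑ i, p i - p m ≤ T)
    {i j : Fin k} (hi : i ≠ m) (hij : i < j ∨ j = m) :
    postponedStart p L T m (Fin.castAdd L i) + p i ≤ postponedStart p L T m (Fin.castAdd L j) := by
  by_cases hj : j = m
  · rw [hj, postponedStart_castAdd_self]
    exact (postponedStart_castAdd_add_le hp hm hi).trans (by simp)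
  · rw [postponedStart_castAdd hi, postponedStart_castAdd hj]
    exact packedStart_add_le (fun i => (hp i).le) (by simpa using hi) (hij.resolve_right hj)

theorem pairwise_disjoint_Ico_postponedStart (hp : ∀ i, 0 < p i) (hT : 0 ≤ T)
    (hm : ∑ i, p i - p m ≤ T) :
    Pairwise (Disjoint on fun i => Ico (postponedStart p L T m i)
      (postponedStart p L T m i + (burstThenStream p hp L hT).size i)) := by
  have disjoint_Ico {a b c d : ℝ} (h : b ≤ c) : Disjoint (Ico a b) (Ico c d) :=
    Ico_disjoint_Ico.2 ((min_le_left _ _).trans (h.trans (le_max_right _ _)))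
  refine (pairwise_disjoint_on _).2 fun i j hij => ?_
  induction i using Fin.addCases with
  | left i =>
    induction j using Fin.addCases with
    | left j =>
      have hij : i < j := hij
      rw [burstThenStream_size_castAdd, burstThenStream_size_castAdd]
      by_cases hi : i = m
      · exact (disjoint_Ico <|
          postponedStart_castAdd_add_le_castAdd hp hm (hi ▸ hij.ne') (.inr hi)).symm
      · exact disjoint_Ico (postponedStart_castAdd_add_le_castAdd hp hm hi (.inl hij))
    | right j =>
      have hj : ((j : ℕ) : ℝ) + 1 ≤ L := by exact_mod_cast j.2
      rw [burstThenStream_size_castAdd, burstThenStream_size_natAdd, postponedStart_natAdd]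
      by_cases hi : i = m
      · exact (disjoint_Ico (by rw [hi, postponedStart_castAdd_self]; linarith)).symm
      · exact disjoint_Ico ((postponedStart_castAdd_add_le hp hm hi).trans (by simp))
  | right i =>
    induction j using Fin.addCases with
    | left j =>
      have hij : k + (i : ℕ) < j := hij
      omega
    | right j =>
      have hij : ((i : ℕ) : ℝ) + 1 ≤ (j : ℕ) := by
        exact_mod_cast Nat.add_lt_add_iff_left.1 (Fin.lt_def.1 hij)
      simp only [burstThenStream_size_natAdd, postponedStart_natAdd]
      exact disjoint_Ico (by linarith)

theorem optCost_burstThenStream_le {α : ℝ} (hα : 0 < α) (hp : ∀ i, 0 < p i) (hT : 0 ≤ T)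
    (hm : ∑ i, p i - p m ≤ T) :
    optCost α (burstThenStream p hp L hT) ≤ ENNReal.ofReal (k * T + 3 * L + 2 * ∑ i, p i) := by
  refine (optCost_le_of_start (I := burstThenStream p hp L hT) hα (postponedStart p L T m)
    (release_le_postponedStart hp hT) (pairwise_disjoint_Ico_postponedStart hp hT hm)).trans
    (ENNReal.ofReal_le_ofReal ?_)
  have hburst (i : Fin k) : postponedStart p L T m (Fin.castAdd L i) + p i
      ≤ T + if i = m then L + p m else 0 := by
    split_ifs with hi
    · rw [hi, postponedStart_castAdd_self, add_assoc]
    · simpa using postponedStart_castAdd_add_le hp hm hi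
  have hsum := Finset.sum_le_sum fun i (_ : i ∈ Finset.univ) => hburst i
  have hpm : p m ≤ ∑ i, p i :=
    Finset.single_le_sum (fun i _ => (hp i).le) (Finset.mem_univ m)
  refine (Fin.sum_univ_add (a := k) (b := L) _).trans_le ?_
  simp only [burstThenStream_release_castAdd, burstThenStream_size_castAdd,
    burstThenStream_release_natAdd, burstThenStream_size_natAdd, postponedStart_natAdd,
    Finset.sum_add_distrib, Finset.sum_sub_distrib, ← Finset.mul_sum, Finset.sum_const,
    Finset.sum_ite_eq', Finset.mem_univ, if_true, Finset.card_univ, Fintype.card_fin,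
    nsmul_eq_mul] at hsum ⊢
  linarith

end postponedStart

theorem sub_le_card_add_val_le {T t : ℝ} {L : ℕ} (ht : t ≤ T + L) :
    t - T ≤ (Finset.card {j : Fin L | T + (j : ℕ) ≤ t} : ℝ) := by
  have hceil : ⌈t - T⌉₊ ≤ L := Nat.ceil_le.2 (by linarith)
  calc t - T ≤ ⌈t - T⌉₊ := Nat.le_ceil _
    _ = (Finset.card {j : Fin L | (j : ℕ) < ⌈t - T⌉₊} : ℝ) := by
        rw [Fin.card_filter_val_lt, min_eq_right hceil]
    _ ≤ _ := by
        gcongr with j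
        intro hj
        linarith [Nat.lt_ceil.1 hj]

theorem add_sub_le_card_release_burstThenStream_le {k : ℕ} (p : Fin k → ℝ) (hp : ∀ i, 0 < p i)
    (L : ℕ) {T t : ℝ} (hT : 0 ≤ T) (hTt : T ≤ t) (ht : t ≤ T + L) :
    k + (t - T) ≤ (Finset.card {i | (burstThenStream p hp L hT).release i ≤ t} : ℝ) := by
  have hcard : Finset.card {i | (burstThenStream p hp L hT).release i ≤ t}
      = k + Finset.card {j : Fin L | T + (j : ℕ) ≤ t} := by
    rw [Finset.card_filter]
    refine (Fin.sum_univ_add (a := k) (b := L) _).trans ?_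
    simp only [burstThenStream_release_castAdd, burstThenStream_release_natAdd, hT.trans hTt,
      if_true, Finset.sum_const, Finset.card_univ, Fintype.card_fin, smul_eq_mul, mul_one,
      ← Finset.card_filter]
  rw [hcard, Nat.cast_add]
  exact add_le_add_right (sub_le_card_add_val_le ht) _

/-- `f` identifies the jobs of `I` with the first jobs of `J`, up to their sizes, and the remaining
jobs of `J` are released at time `T` or later. -/
structure Instance.IsExtension (I J : Instance) (T : ℝ) (f : Fin I.n → Fin J.n) : Prop where
  val_eq : ∀ i, (f i : ℕ) = i
  release_eq : ∀ i, J.release (f i) = I.release i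
  le_release : ∀ j, j ∉ range f → T ≤ J.release j

theorem Instance.IsExtension.arrivals_eq {I J : Instance} {T : ℝ} {f : Fin I.n → Fin J.n}
    (h : I.IsExtension J T f) {t : ℝ} (ht : t < T) : I.arrivals t = J.arrivals t := by
  ext e
  constructor
  · rintro ⟨i, hi, rfl⟩
    exact ⟨f i, by rwa [h.release_eq], by rw [h.val_eq, h.release_eq]⟩
  · rintro ⟨j, hj, rfl⟩
    obtain ⟨i, rfl⟩ : j ∈ range f := by
      by_contra hj'
      exact ((h.le_release j hj').trans hj).not_gt ht
    exact ⟨i, by rwa [← h.release_eq], by rw [h.val_eq, h.release_eq]⟩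

theorem Schedule.completions_eq_empty_of_work_lt {I : Instance} (σ : Schedule I) {T : ℝ}
    (h : ∀ t ∈ Ico 0 T, (∀ s ∈ Ico 0 t, σ.completions s = ∅) → ∀ i, σ.work i t < I.size i)
    {t : ℝ} (ht : t ∈ Ico 0 T) : σ.completions t = ∅ := by
  refine σ.completions_eq_empty fun j => ?_
  obtain ⟨m, -, hm⟩ := Finset.exists_min_image Finset.univ σ.completionTime ⟨j, Finset.mem_univ j⟩
  refine lt_of_lt_of_le ?_ (hm j (Finset.mem_univ j))
  by_contra! hle
  have htop : σ.completionTime m ≠ ∞ := (hle.trans_lt ENNReal.ofReal_lt_top).ne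
  set τ := (σ.completionTime m).toReal with hτ
  have hτT : τ ∈ Ico 0 T :=
    ⟨ENNReal.toReal_nonneg, (ENNReal.toReal_le_of_le_ofReal ht.1 hle).trans_lt ht.2⟩
  have hbefore (s : ℝ) (hs : s ∈ Ico 0 τ) : σ.completions s = ∅ :=
    σ.completions_eq_empty fun j =>
      ((ENNReal.ofReal_lt_iff_lt_toReal hs.1 htop).2 hs.2).trans_le (hm j (Finset.mem_univ j))
  have hlt := σ.lt_completionTime hτT.1 (h τ hτT hbefore m)
  rw [hτ, ENNReal.ofReal_toReal htop] at hlt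
  exact hlt.false

namespace NonclairvoyantAlgorithm

theorem work_run_eq_of_isExtension (A : NonclairvoyantAlgorithm) {I J : Instance} {T : ℝ}
    {f : Fin I.n → Fin J.n} (h : I.IsExtension J T f)
    (hI : ∀ i, (A.run I).work i T < I.size i) (hJ : ∀ i, (A.run I).work i T < J.size (f i))
    (i : Fin I.n) : (A.run J).work (f i) T = (A.run I).work i T := by
  have hIc (t : ℝ) (ht : t ∈ Ico 0 T) : (A.run I).completions t = ∅ :=
    Schedule.completions_eq_empty _ fun i =>
      Schedule.lt_completionTime _ ht.1 (((A.run I).work_mono i ht.2.le).trans_lt (hI i))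
  have hrate (t : ℝ) (ht : t ∈ Ico 0 T) (hJt : (A.run J).completions t = ∅) (i : Fin I.n) :
      (A.run J).rate (f i) t = (A.run I).rate i t :=
    (A.nonclairvoyant I J t ht.1 (h.arrivals_eq ht.2) ((hIc t ht).trans hJt.symm) i (f i)
      (h.val_eq i).symm).symm
  have hwork {t : ℝ} (ht : t ≤ T) (hJt : ∀ s ∈ Ico 0 t, (A.run J).completions s = ∅)
      (i : Fin I.n) : (A.run J).work (f i) t = (A.run I).work i t :=
    congrArg ENNReal.toReal <| workDone_congr fun s hs =>
      hrate s ⟨hs.1, hs.2.trans_le ht⟩ (hJt s hs) i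
  have hJc (t : ℝ) (ht : t ∈ Ico 0 T) : (A.run J).completions t = ∅ := by
    refine Schedule.completions_eq_empty_of_work_lt _ (fun t ht hbefore j => ?_) ht
    by_cases hj : j ∈ range f
    · obtain ⟨i, rfl⟩ := hj
      rw [hwork ht.2.le hbefore]
      exact ((A.run I).work_mono i ht.2.le).trans_lt (hJ i)
    · rw [Schedule.work_eq_zero_of_le_release _ (ht.2.le.trans (h.le_release j hj))]
      exact J.size_pos j
  exact hwork le_rfl hJc i

end NonclairvoyantAlgorithm

theorem isExtension_burst_burstThenStream {k : ℕ} {p q : Fin k → ℝ} (hp : ∀ i, 0 < p i)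
    (hq : ∀ i, 0 < q i) (L : ℕ) {T : ℝ} (hT : 0 ≤ T) :
    (burst p hp).IsExtension (burstThenStream q hq L hT) T (Fin.castAdd L) where
  val_eq _ := rfl
  release_eq := burstThenStream_release_castAdd q hq L hT
  le_release j hj := by
    induction j using Fin.addCases with
    | left i => exact absurd ⟨i, rfl⟩ hj
    | right j =>
      rw [burstThenStream_release_natAdd]
      exact le_add_of_nonneg_right (Nat.cast_nonneg _)

theorem NonclairvoyantAlgorithm.work_run_burstThenStream (A : NonclairvoyantAlgorithm) {k : ℕ}
    {p q : Fin k → ℝ} (hp : ∀ i, 0 < p i) (hq : ∀ i, 0 < q i) (L : ℕ) {T : ℝ} (hT : 0 ≤ T)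
    (hwp : ∀ i, (A.run (burst p hp)).work i T < p i)
    (hwq : ∀ i, (A.run (burst p hp)).work i T < q i) (i : Fin k) :
    (A.run (burstThenStream q hq L hT)).work (Fin.castAdd L i) T
      = (A.run (burst p hp)).work i T :=
  A.work_run_eq_of_isExtension (isExtension_burst_burstThenStream hp hq L hT) hwp
    (fun i => (hwq i).trans_eq (burstThenStream_size_castAdd q hq L hT i).symm) i

namespace NonclairvoyantAlgorithm.IsCompetitive

variable {A : NonclairvoyantAlgorithm} {α C : ℝ}

theorem one_le (hA : A.IsCompetitive α C) (hα : 0 < α) : 1 ≤ C := by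
  set I := burst (1 : Fin 1 → ℝ) fun _ => one_pos
  have hopt : optCost α I ≠ ∞ := ne_top_of_le_ne_top ENNReal.ofReal_ne_top (optCost_burst_le hα _ _)
  have hcost_ne_zero : (A.run I).cost α ≠ 0 := (A.run I).cost_ne_zero hα (0 : Fin 1)
  have hcost_ne_top : (A.run I).cost α ≠ ∞ :=
    ne_top_of_le_ne_top (ENNReal.mul_ne_top ENNReal.ofReal_ne_top hopt) (hA I)
  rw [← ENNReal.one_le_ofReal, ← ENNReal.mul_le_mul_iff_left hcost_ne_zero hcost_ne_top, one_mul]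
  calc (A.run I).cost α ≤ ENNReal.ofReal C * optCost α I := hA I
    _ ≤ ENNReal.ofReal C * (A.run I).cost α := by gcongr; exact iInf_le _ _

theorem cost_le (hA : A.IsCompetitive α C) (hα : 0 < α) {I : Instance} {B : ℝ}
    (hopt : optCost α I ≤ ENNReal.ofReal B) : (A.run I).cost α ≤ ENNReal.ofReal (C * B) := by
  rw [ENNReal.ofReal_mul (zero_le_one.trans (hA.one_le hα))]
  exact (hA I).trans (by gcongr)

theorem totalWork_le (hA : A.IsCompetitive α C) (hα : 1 ≤ α) {I : Instance} {B l a b : ℝ}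
    (hB : 0 ≤ B) (hopt : optCost α I ≤ ENNReal.ofReal B) (hl : 0 < l) (ha : 0 ≤ a) (hab : a ≤ b) :
    (A.run I).totalWork b
      ≤ (A.run I).totalWork a + (l * (b - a) + (α * l ^ (α - 1))⁻¹ * (C * B)) := by
  have hα' : 0 < α := zero_lt_one.trans_le hα
  exact (A.run I).totalWork_le hα hl ha hab (mul_nonneg (zero_le_one.trans (hA.one_le hα')) hB)
    (le_add_self.trans (hA.cost_le hα' hopt))

theorem sub_mul_le (hA : A.IsCompetitive α C) (hα : 1 ≤ α) {k L : ℕ} {p : Fin k → ℝ}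
    {hp : ∀ i, 0 < p i} {T : ℝ} {hT : 0 ≤ T} {B : ℝ} (hB : 0 ≤ B)
    (hopt : optCost α (burstThenStream p hp L hT) ≤ ENNReal.ofReal B)
    (hrem : ∀ i, (A.run (burstThenStream p hp L hT)).work (Fin.castAdd L i) T + 1 ≤ p i) :
    (k - α⁻¹ * (C * B)) * L ≤ C * B := by
  have hα' : 0 < α := zero_lt_one.trans_le hα
  have hCB : 0 ≤ C * B := mul_nonneg (zero_le_one.trans (hA.one_le hα')) hB
  set J := burstThenStream p hp L hT
  have hrem' (i : Fin J.n) : (A.run J).work i T + 1 ≤ J.size i := by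
    induction i using Fin.addCases with
    | left i =>
      rw [burstThenStream_size_castAdd]
      exact hrem i
    | right j =>
      have hzero : (A.run J).work (Fin.natAdd k j) T = 0 :=
        Schedule.work_eq_zero_of_le_release _ <|
          (le_add_of_nonneg_right (Nat.cast_nonneg _)).trans_eq
            (burstThenStream_release_natAdd p hp L hT j).symm
      linarith [burstThenStream_size_natAdd p hp L hT j]
  have hactive (t : ℝ) (ht : t ∈ Icc T (T + L)) :
      k - α⁻¹ * (C * B) ≤ (A.run J).numActive t := by
    have hwork := hA.totalWork_le hα hB hopt one_pos hT ht.1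
    rw [Real.one_rpow, mul_one, one_mul] at hwork
    linarith [add_sub_le_card_release_burstThenStream_le p hp L hT ht.1 ht.2,
      (A.run J).card_released_sub_le_numActive (hT.trans ht.1) ht.1 fun i _ => hrem' i]
  have hflow := (A.run J).mul_le_totalFlowTime hactive
  rw [add_sub_cancel_left, ← ENNReal.ofReal_mul' (Nat.cast_nonneg L)] at hflow
  exact (ENNReal.ofReal_le_ofReal_iff hCB).1 <|
    hflow.trans (le_self_add.trans (hA.cost_le hα' hopt))

end NonclairvoyantAlgorithm.IsCompetitive

theorem inv_mul_one_add_rpow_le {α k : ℝ} (hk : 0 < k) (hα : 2 ≤ α) :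
    (α * (1 + 1 / (4 * k)) ^ (α - 1))⁻¹ ≤ 8 * k / α ^ 2 := by
  have hkinv : 0 < 1 / (4 * k) := by positivity
  have hbern : 1 + (α - 1) * (1 / (4 * k)) ≤ (1 + 1 / (4 * k)) ^ (α - 1) :=
    one_add_mul_self_le_rpow_one_add (by linarith) (by linarith)
  have hhalf : α / 2 * (1 / (4 * k)) ≤ (α - 1) * (1 / (4 * k)) := by gcongr; linarith
  have : 0 < α := by linarith
  refine (inv_anti₀ (by positivity) ?_).trans_eq (inv_div _ _)
  calc α ^ 2 / (8 * k) = α * (α / 2 * (1 / (4 * k))) := by field_simp; norm_num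
    _ ≤ α * (1 + 1 / (4 * k)) ^ (α - 1) := by gcongr; linarith

theorem optCost_burstThenStream_le_of_sum_le {α : ℝ} (hα : 0 < α) {k : ℕ} (hk : 1 ≤ k)
    {p : Fin k → ℝ} (hp : ∀ i, 0 < p i) (hT : (0 : ℝ) ≤ 2 * k ^ 2)
    (hsum : ∑ i, p i ≤ 2 * k ^ 2 + 2 * k) :
    optCost α (burstThenStream p hp (k ^ 3) hT) ≤ ENNReal.ofReal (13 * k ^ 3) := by
  have hk1 : (1 : ℝ) ≤ k := by exact_mod_cast hk
  obtain ⟨m, -, hm⟩ : ∃ m ∈ Finset.univ, (∑ i, p i) / k ≤ p m :=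
    Finset.exists_le_of_sum_le ⟨⟨0, hk⟩, Finset.mem_univ _⟩ <| le_of_eq <| by
      rw [Finset.sum_const, Finset.card_univ, Fintype.card_fin, nsmul_eq_mul]
      field_simp
  have hothers : ∑ i, p i - p m ≤ 2 * k ^ 2 :=
    calc ∑ i, p i - p m ≤ ∑ i, p i - (∑ i, p i) / k := by gcongr
      _ = (∑ i, p i) * ((k - 1) / k) := by field_simp
      _ ≤ (2 * (k : ℝ) ^ 2 + 2 * k) * ((k - 1) / k) := by gcongr
      _ = 2 * (k : ℝ) ^ 2 - 2 := by field_simp; ring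
      _ ≤ 2 * (k : ℝ) ^ 2 := by linarith
  refine (optCost_burstThenStream_le hα hp hT hothers).trans (ENNReal.ofReal_le_ofReal ?_)
  have hk2 : (k : ℝ) ^ 2 ≤ k ^ 3 := pow_le_pow_right₀ hk1 (by norm_num)
  have hk3 : (k : ℝ) ≤ k ^ 3 := le_self_pow₀ hk1 (by norm_num)
  calc k * (2 * (k : ℝ) ^ 2) + 3 * (k ^ 3 : ℕ) + 2 * ∑ i, p i
      ≤ k * (2 * (k : ℝ) ^ 2) + 3 * (k ^ 3 : ℕ) + 2 * (2 * k ^ 2 + 2 * k) := by gcongr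
    _ ≤ 13 * (k : ℝ) ^ 3 := by push_cast; linarith

namespace NonclairvoyantAlgorithm.IsCompetitive

variable {A : NonclairvoyantAlgorithm} {α C : ℝ}

theorem totalWork_burst_le (hA : A.IsCompetitive α C) {k : ℕ} (hk : 1 ≤ k) (hkα : 10 * k ^ 3 ≤ α)
    (hCk : 30 * C ≤ k) (hp : ∀ _ : Fin k, (0 : ℝ) < 4 * k ^ 2) :
    (A.run (burst (fun _ => 4 * k ^ 2) hp)).totalWork (2 * k ^ 2) ≤ 2 * k ^ 2 + k := by
  have hk1 : (1 : ℝ) ≤ k := by exact_mod_cast hk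
  have hα : 10 ≤ α := by linarith [one_le_pow₀ hk1 (n := 3)]
  have hopt : optCost α (burst (fun _ : Fin k => 4 * (k : ℝ) ^ 2) hp)
      ≤ ENNReal.ofReal (8 * k ^ 4) := by
    refine (optCost_burst_le (by linarith) _ hp).trans (ENNReal.ofReal_le_ofReal ?_)
    rw [Finset.sum_const, Finset.card_univ, Fintype.card_fin, nsmul_eq_mul]
    calc ((k : ℝ) + 1) * (k * (4 * k ^ 2)) ≤ (k + k) * (k * (4 * (k : ℝ) ^ 2)) := by gcongr
      _ = 8 * (k : ℝ) ^ 4 := by ring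
  have hwork := hA.totalWork_le (l := 1 + 1 / (4 * k)) (b := 2 * k ^ 2) (by linarith)
    (by positivity) hopt (by positivity) le_rfl (by positivity)
  have hC : 0 ≤ C := zero_le_one.trans (hA.one_le (by linarith))
  have hexcess : (α * (1 + 1 / (4 * (k : ℝ))) ^ (α - 1))⁻¹ * (C * (8 * k ^ 4)) ≤ k / 2 :=
    calc (α * (1 + 1 / (4 * (k : ℝ))) ^ (α - 1))⁻¹ * (C * (8 * k ^ 4))
        ≤ 8 * k / α ^ 2 * (k / 30 * (8 * (k : ℝ) ^ 4)) := by
          gcongr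
          · exact inv_mul_one_add_rpow_le (by linarith) (by linarith)
          · linarith
      _ ≤ 8 * k / (10 * k ^ 3) ^ 2 * (k / 30 * (8 * (k : ℝ) ^ 4)) := by gcongr
      _ ≤ (k : ℝ) / 2 := by
          field_simp
          linarith
  calc (A.run (burst (fun _ => 4 * k ^ 2) hp)).totalWork (2 * k ^ 2)
      ≤ 0 + ((1 + 1 / (4 * k)) * (2 * k ^ 2 - 0) + k / 2) := by
        rw [Schedule.totalWork_zero] at hwork
        linarith
    _ = 2 * k ^ 2 + k := by field_simp; ring

theorem natCast_le (hA : A.IsCompetitive α C) {k : ℕ} (hk : 1 ≤ k) (hkα : 10 * k ^ 3 ≤ α) :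
    k ≤ 30 * C := by
  by_contra! hCk
  have hk1 : (1 : ℝ) ≤ k := by exact_mod_cast hk
  have hα : 10 ≤ α := by linarith [one_le_pow₀ hk1 (n := 3)]
  set T : ℝ := 2 * k ^ 2
  have hT : 0 ≤ T := by positivity
  set I := burst (fun _ : Fin k => 4 * (k : ℝ) ^ 2) fun _ => by positivity
  have hwork : (A.run I).totalWork T ≤ 2 * k ^ 2 + k := hA.totalWork_burst_le hk hkα hCk.le _
  set p : Fin k → ℝ := fun i => (A.run I).work i T + 1
  have hp (i : Fin k) : 0 < p i := by linarith [(A.run I).work_nonneg i T]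
  set J := burstThenStream p hp (k ^ 3) hT
  have hopt : optCost α J ≤ ENNReal.ofReal (13 * k ^ 3) := by
    refine optCost_burstThenStream_le_of_sum_le (by linarith) hk hp hT ?_
    calc ∑ i, p i = (A.run I).totalWork T + ∑ _ : Fin k, 1 := Finset.sum_add_distrib
      _ = (A.run I).totalWork T + k := by simp
      _ ≤ 2 * k ^ 2 + 2 * k := by linarith
  have hagree (i : Fin k) : (A.run J).work (Fin.castAdd (k ^ 3) i) T = (A.run I).work i T := by
    refine A.work_run_burstThenStream _ hp (k ^ 3) hT (fun i => ?_) (fun i => lt_add_one _) i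
    calc (A.run I).work i T ≤ (A.run I).totalWork T :=
          Finset.single_le_sum (fun i _ => (A.run I).work_nonneg i T) (Finset.mem_univ i)
      _ < 4 * (k : ℝ) ^ 2 := by nlinarith
  have hflow := hA.sub_mul_le (by linarith) (by positivity) hopt fun i => by rw [hagree i]
  have hcost : C * (13 * k ^ 3) ≤ k / 2 * k ^ 3 := by
    rw [← mul_assoc]
    gcongr
    linarith
  have hC : 0 ≤ C := zero_le_one.trans (hA.one_le (by linarith))
  have hahead : α⁻¹ * (C * (13 * k ^ 3)) ≤ k / 20 :=
    calc α⁻¹ * (C * (13 * k ^ 3)) ≤ (10 * (k : ℝ) ^ 3)⁻¹ * (k / 2 * k ^ 3) := by gcongr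
      _ = (k : ℝ) / 20 := by field_simp; norm_num
  rw [Nat.cast_pow] at hflow
  linarith [le_of_mul_le_mul_right (hflow.trans hcost) (by positivity)]

end NonclairvoyantAlgorithm.IsCompetitive

end SpeedScaling

theorem theorem2_general {α : ℝ} (hα : 0 < α) {A : SpeedScaling.NonclairvoyantAlgorithm} {C : ℝ}
    (hA : A.IsCompetitive α C) : 1 / 180 * α ^ (1 / 3 : ℝ) ≤ C := by
  set x : ℝ := α ^ (1 / 3 : ℝ) with hx
  have hx_pow : x ^ 3 = α := by
    rw [hx, ← Real.rpow_natCast, ← Real.rpow_mul hα.le]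
    norm_num
  rcases lt_or_ge x 3 with hsmall | hlarge
  · linarith [hA.one_le hα]
  set k := ⌊x / 3⌋₊
  have hk : 1 ≤ k := Nat.le_floor (by rw [Nat.cast_one]; linarith)
  have hk1 : (1 : ℝ) ≤ k := by exact_mod_cast hk
  have hkα : 10 * (k : ℝ) ^ 3 ≤ α :=
    calc 10 * (k : ℝ) ^ 3 ≤ 10 * (x / 3) ^ 3 := by gcongr; exact Nat.floor_le (by linarith)
      _ = 10 / 27 * α := by rw [← hx_pow]; ring
      _ ≤ α := by linarith
  linarith [hA.natCast_le hk hkα, Nat.lt_floor_add_one (x / 3)]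

theorem theorem2 (ε : ℝ) (hε : 0 < ε) (hε' : ε < 1 / 3) :
    ∃ c : ℝ, 0 < c ∧ ∀ α : ℝ, 1 < α →
      ∀ (A : SpeedScaling.NonclairvoyantAlgorithm) (C : ℝ),
        A.IsCompetitive α C → c * α ^ (1 / 3 - ε) ≤ C := by
  refine ⟨1 / 180, by norm_num, fun α hα A C hA => le_trans ?_ <|
    theorem2_general (zero_lt_one.trans hα) hA⟩
  gcongr 1 / 180 * ?_
  exact Real.rpow_le_rpow_of_exponent_le hα.le (by linarith)
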